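/- Let $k,n\ge 1$ be integers. Let $s(n,k)$ denote the (signed) Stirling numbers of the first kind, given by $\frac{[\ln(1+x)]^k}{k!}=\sum_{n\ge k}s(n,k)\frac{x^n}{n!}$ for $|x|<1$, and for integers $k\ge1$, $m\ge2$ put $$Q(k,m)=\sum_{\ell=0}^{m}\binom{k+\ell-1}{k-1}\,s(k+m-1,k+\ell-1)\left(\frac{k+m-2}{2}\right)^{\ell}.$$ For $-1\le x\le 1$ let $\operatorname{arccosh}x$ denote the principal value $\operatorname{arccosh}x=\ln\bigl(x+\sqrt{x+1}\,\sqrt{x-1}\bigr)\in\mathbb{C}$. For a function $f$ on $[-1,1]$, $f^{(n)}(x)\big|_{x=1^-}=c$ means that $f$ is $n$ times continuously differentiable (one-sidedly at $1$) on some interval $(1-\varepsilon,1]$, that its $n$-th left-hand derivative at $1$ is $c$, and that $f^{(n)}(x)\to c$ as $x\to1^-$. Then $$\bigl[(\arccos x)^{2k}\bigr]^{(n)}\Big|_{x=1^-}=\begin{cases}0,& n<k;\\ (-1)^k(2k)!!,& n=k;\\ (-1)^k\dfrac{(2k)!}{(2n-1)!!}\,Q(2k,2n-2k),& n>k,\end{cases}$$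 and $$\bigl[(\operatorname{arccosh} x)^{2k}\bigr]^{(n)}\Big|_{x=1^-}=\begin{cases}0,& n<k;\\ (2k)!!,& n=k;\\ \dfrac{(2k)!}{(2n-1)!!}\,Q(2k,2n-2k),& n>k.\end{cases}$$ -/

import Mathlib

open Set Filter Topology
open scoped Nat

/-- The signed Stirling numbers of the first kind `s(n, k)`, i.e. the numbers with
`(log (1 + x)) ^ k / k! = ∑_{n ≥ k} s(n, k) x ^ n / n!`; they are `(-1) ^ (n - k)` times the number
of permutations of `n` elements with `k` cycles, and vanish for `k > n`. -/
def signedStirlingFirst (n k : ℕ) : ℤ :=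
  (-1) ^ (n - k) * (Nat.stirlingFirst n k : ℤ)

/-- `Q(k, m) = ∑_{ℓ = 0}^{m} C(k + ℓ - 1, k - 1) s(k + m - 1, k + ℓ - 1) ((k + m - 2) / 2) ^ ℓ`,
meant for `k ≥ 1` and `m ≥ 2` (so that no subtraction of natural numbers is truncated). -/
noncomputable def stirlingQ (k m : ℕ) : ℝ :=
  ∑ ℓ ∈ Finset.range (m + 1),
    (Nat.choose (k + ℓ - 1) (k - 1) : ℝ) * (signedStirlingFirst (k + m - 1) (k + ℓ - 1) : ℝ)
      * (((k : ℝ) + (m : ℝ) - 2) / 2) ^ ℓ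

/-- The principal branch of the inverse hyperbolic cosine,
`arccosh z = log (z + √(z + 1) √(z - 1))`, with principal logarithm and square roots. -/
noncomputable def complexArccosh (z : ℂ) : ℂ :=
  Complex.log (z + (z + 1) ^ (1 / 2 : ℂ) * (z - 1) ^ (1 / 2 : ℂ))

/-- `f ^ (n)` at `a⁻` exists and equals `c`: on the closed left side of `a` the function `f` is
`n` times continuously differentiable near `a`, the `n`-th one-sided derivative at `a` is `c`, and
`c` is also the limit of the ordinary `n`-th derivative of `f` at `x` as `x → a⁻`. -/
structure HasLeftIteratedDeriv {F : Type*} [NormedAddCommGroup F] [NormedSpace ℝ F]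
    (n : ℕ) (f : ℝ → F) (c : F) (a : ℝ) : Prop where
  contDiffWithinAt : ContDiffWithinAt ℝ n f (Iic a) a
  iteratedDerivWithin_eq : iteratedDerivWithin n f (Iic a) a = c
  tendsto_iteratedDeriv : Tendsto (iteratedDeriv n f) (𝓝[<] a) (𝓝 c)

open Set Filter Topology
open scoped Nat

/-! Although `arccos` is not differentiable at 1, its square agrees on the left of 1 with a function
`g` analytic at 1. There `(1 - x²) g'² = 4 g` and `(1 - x²) g'' - x g' = 2`, so `y = g ^ (k + 1)`
satisfies `(1 - x²) y'' - x y' = (2k + 2)(2k + 1) g ^ k`. Differentiating `n` times and setting `x =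
1` kills the leading term and leaves a recurrence in `n` and `k`, solved up to factorials by the
coefficients of `∏_{j < n} (t - j²)` (`iteratedDeriv_pow_one`). These coefficients are the sums `Q`,
by expanding a falling factorial about the midpoint of its roots (`stirlingQ_eq_coeff`). On `[-1,
1]`, `arccosh = i arccos`, which only contributes the sign `(-1) ^ k`. -/

/-! ### Stirling sums as central factorial numbers -/

theorem coeff_descPochhammer_real (n j : ℕ) :
    (descPochhammer ℝ n).coeff j = (signedStirlingFirst n j : ℝ) := by
  induction n generalizing j with
  | zero => cases j <;> simp [signedStirlingFirst, Polynomial.coeff_one]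
  | succ n ih =>
    rw [descPochhammer_succ_right, mul_sub, Polynomial.coeff_sub, ← Polynomial.C_eq_natCast,
      Polynomial.coeff_mul_C]
    cases j with
    | zero =>
      rw [Polynomial.coeff_mul_X_zero, ih]
      cases n <;> simp [signedStirlingFirst]
    | succ j =>
      rw [Polynomial.coeff_mul_X, ih, ih]
      simp only [signedStirlingFirst, Nat.stirlingFirst_succ_succ, Nat.add_sub_add_right]
      rcases Nat.lt_or_ge n (j + 1) with h | h
      · simp [Nat.stirlingFirst_eq_zero_of_lt h]
      · obtain ⟨d, rfl⟩ := Nat.exists_eq_add_of_le h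
        have h1 : j + 1 + d - j = d + 1 := by omega
        have h2 : j + 1 + d - (j + 1) = d := by omega
        rw [h1, h2]
        push_cast
        ring

/-- The polynomial `∏_{j < n} (t - j ^ 2)`, whose coefficients are central factorial numbers. -/
noncomputable def centralFactorialPoly (n : ℕ) : Polynomial ℝ :=
  ∏ j ∈ Finset.range n, (Polynomial.X - Polynomial.C ((j : ℝ) ^ 2))

theorem centralFactorialPoly_succ (n : ℕ) :
    centralFactorialPoly (n + 1) =
      centralFactorialPoly n * (Polynomial.X - Polynomial.C ((n : ℝ) ^ 2)) :=
  Finset.prod_range_succ _ _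

theorem coeff_centralFactorialPoly_succ_zero (n : ℕ) :
    (centralFactorialPoly (n + 1)).coeff 0 = 0 := by
  rw [centralFactorialPoly, Finset.prod_range_succ']
  simp [Polynomial.mul_coeff_zero]

theorem monic_centralFactorialPoly (n : ℕ) : (centralFactorialPoly n).Monic :=
  Polynomial.monic_prod_of_monic _ _ fun _ _ => Polynomial.monic_X_sub_C _

theorem natDegree_centralFactorialPoly (n : ℕ) : (centralFactorialPoly n).natDegree = n := by
  rw [centralFactorialPoly, Polynomial.natDegree_prod_of_monic _ _
    fun _ _ => Polynomial.monic_X_sub_C _]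
  simp only [Polynomial.natDegree_X_sub_C, Finset.sum_const, Finset.card_range, smul_eq_mul,
    mul_one]

/-- Translation by `m` moves the roots `0, …, 2m` to `-m, …, m`; the roots `±j` pair into `X² - j²`,
and the extra `X` doubles the root 0. -/
theorem taylor_descPochhammer (m : ℕ) :
    Polynomial.X * Polynomial.taylor (m : ℝ) (descPochhammer ℝ (2 * m + 1)) =
      Polynomial.expand ℝ 2 (centralFactorialPoly (m + 1)) := by
  have hd (n : ℕ) : descPochhammer ℝ n =
      ∏ i ∈ Finset.range n, (Polynomial.X - Polynomial.C (i : ℝ)) := by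
    induction n with
    | zero => simp
    | succ n ih => rw [descPochhammer_succ_right, Finset.prod_range_succ, ih]; simp
  have ht (m n : ℕ) : Polynomial.taylor (m : ℝ) (descPochhammer ℝ n) =
      ∏ i ∈ Finset.range n, (Polynomial.X + Polynomial.C (m : ℝ) - Polynomial.C (i : ℝ)) := by
    rw [hd, Polynomial.taylor_apply, Polynomial.prod_comp]
    simp
  induction m with
  | zero => simp [centralFactorialPoly, sq]
  | succ m ih =>
    rw [centralFactorialPoly_succ, map_mul, ← ih, ht, ht,
      show 2 * (m + 1) + 1 = (2 * m + 1) + 1 + 1 by ring, Finset.prod_range_succ,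
      Finset.prod_range_succ']
    have hc : ∀ i ∈ Finset.range (2 * m + 1),
        (Polynomial.X + Polynomial.C ((m + 1 : ℕ) : ℝ) - Polynomial.C ((i + 1 : ℕ) : ℝ)) =
        (Polynomial.X + Polynomial.C (m : ℝ) - Polynomial.C (i : ℝ)) := by
      intro i _
      push_cast
      simp only [map_add]
      ring
    rw [Finset.prod_congr rfl hc]
    simp only [map_sub, Polynomial.expand_X, Polynomial.expand_C]
    push_cast
    simp only [map_add, map_pow, map_mul, map_one, map_zero, map_ofNat]
    ring

theorem stirlingQ_eq_coeff {k n : ℕ} (hk : 1 ≤ k) (h : k < n) :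
    stirlingQ (2 * k) (2 * n - 2 * k) = (centralFactorialPoly n).coeff k := by
  obtain ⟨m, rfl⟩ := Nat.exists_eq_add_of_le' (hk.trans h.le)
  obtain ⟨j, hj⟩ : ∃ j, 2 * k = j + 1 := ⟨2 * k - 1, by omega⟩
  obtain ⟨d, hd⟩ : ∃ d, 2 * (m + 1) - 2 * k = d := ⟨_, rfl⟩
  -- The base of the powers in `Q` is exactly the midpoint of the roots.
  have hr : ((2 * k : ℕ) + (d : ℕ) - 2 : ℝ) / 2 = m := by
    have : ((2 * k + d : ℕ) : ℝ) = ((2 * (m + 1) : ℕ) : ℝ) := by congr 1; omega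
    push_cast at this ⊢
    linarith
  rw [← Polynomial.coeff_expand_mul' (p := 2) (by norm_num), ← taylor_descPochhammer, hj,
    Polynomial.coeff_X_mul, Polynomial.taylor_coeff, Polynomial.eval_eq_sum_range' (n := d + 1),
    stirlingQ, ← hj, hd]
  · refine Finset.sum_congr rfl fun l _ => ?_
    rw [Polynomial.hasseDeriv_coeff, coeff_descPochhammer_real, hr,
      show 2 * k + l - 1 = l + j by omega, show 2 * k - 1 = j by omega,
      show 2 * k + d - 1 = 2 * m + 1 by omega]
  · refine (Polynomial.natDegree_hasseDeriv_le _ _).trans_lt ?_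
    rw [descPochhammer_natDegree]
    omega

/-! ### The analytic germ of the squared arccosine and its derivatives -/

theorem exists_analyticAt_cos_eq_comp_sq :
    ∃ C : ℝ → ℝ, AnalyticAt ℝ C 0 ∧ deriv C 0 ≠ 0 ∧ C 0 = 1 ∧
      ∀ᶠ t in 𝓝 0, C (t ^ 2) = Real.cos t := by
  -- Cosine is even: these are its Taylor coefficients as a series in `u = t²`.
  let c : ℕ → ℝ := fun j => (-1) ^ j / ((2 * j)! : ℝ)
  have hr : ((1 : NNReal) : ENNReal) ≤ (FormalMultilinearSeries.ofScalars ℝ c).radius := by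
    refine FormalMultilinearSeries.le_radius_of_bound _ 1 fun n => ?_
    rw [FormalMultilinearSeries.ofScalars_norm]
    simp only [c, norm_div, norm_pow, norm_neg, norm_one, one_pow, NNReal.coe_one, mul_one,
      RCLike.norm_natCast]
    exact div_le_one_of_le₀ (mod_cast Nat.factorial_pos _) (by positivity)
  have hs := (FormalMultilinearSeries.ofScalars ℝ c).hasFPowerSeriesOnBall
    (lt_of_lt_of_le (by norm_num) hr)
  have hd := hs.hasFPowerSeriesAt.hasStrictDerivAt.hasDerivAt.deriv
  refine ⟨(FormalMultilinearSeries.ofScalars ℝ c).sum, hs.analyticAt, ?_, ?_, Eventually.of_forall fun t => ?_⟩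
  · rw [hd]
    simp [c]
  · exact (FormalMultilinearSeries.ofScalarsSum_zero c).trans (by simp [c])
  · refine (FormalMultilinearSeries.ofScalars_sum_eq c (t ^ 2)).trans ?_
    rw [← (Real.hasSum_cos t).tsum_eq]
    refine tsum_congr fun n => ?_
    simp only [c, smul_eq_mul, ← pow_mul]
    ring

/-- Since `cos t = C (t²)` with `C' 0 ≠ 0`, the local inverse of `C` at 0 recovers `t²` from `cos
t`. -/
theorem exists_analyticAt_eq_arccos_sq :
    ∃ g : ℝ → ℝ, AnalyticAt ℝ g 1 ∧ ∀ᶠ x in 𝓝[≤] (1 : ℝ), g x = Real.arccos x ^ 2 := by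
  obtain ⟨C, hC, hd, h0, hcos⟩ := exists_analyticAt_cos_eq_comp_sq
  refine ⟨_, h0 ▸ hC.analyticAt_localInverse hd, ?_⟩
  have ht : Tendsto Real.arccos (𝓝[≤] 1) (𝓝 0) := by
    have := Real.continuous_arccos.tendsto 1
    rw [Real.arccos_one] at this
    exact this.mono_left nhdsWithin_le_nhds
  have ht2 : Tendsto (fun x => Real.arccos x ^ 2) (𝓝[≤] 1) (𝓝 0) := by
    simpa using ht.pow 2
  have hl := ht2.eventually (HasStrictDerivAt.eventually_left_inverse hC.hasStrictDerivAt hd)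
  have hm : ∀ᶠ x in 𝓝[≤] (1 : ℝ), -1 ≤ x :=
    nhdsWithin_le_nhds (Ici_mem_nhds (by norm_num))
  filter_upwards [hl, ht.eventually hcos, hm, self_mem_nhdsWithin] with x h1 h2 h3 h4
  rwa [h2, Real.cos_arccos h3 h4] at h1

theorem arccos_sq_ode {g : ℝ → ℝ} (hg : AnalyticAt ℝ g 1)
    (h : ∀ᶠ x in 𝓝[≤] (1 : ℝ), g x = Real.arccos x ^ 2) :
    (∀ᶠ x in 𝓝 1, (1 - x ^ 2) * deriv g x ^ 2 = 4 * g x) ∧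
      ∀ᶠ x in 𝓝 1, (1 - x ^ 2) * deriv (deriv g) x - x * deriv g x = 2 := by
  have hmem : ∀ᶠ x in 𝓝[<] (1 : ℝ), x ∈ Ioo (-1 : ℝ) 1 :=
    Ioo_mem_nhdsLT (by norm_num)
  have hsub : 𝓝[<] (1 : ℝ) ≤ 𝓝[≠] 1 := nhdsWithin_mono _ fun x hx => ne_of_lt hx
  have h1 : ∀ᶠ x in 𝓝[<] (1 : ℝ), g =ᶠ[𝓝 x] fun y => Real.arccos y ^ 2 := by
    have := eventually_eventually_nhdsWithin.2 (h.filter_mono (nhdsWithin_mono _ Iio_subset_Iic_self))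
    filter_upwards [this, self_mem_nhdsWithin] with x hx hx1
    rwa [isOpen_Iio.nhdsWithin_eq hx1] at hx
  have hder (x : ℝ) (hx : x ∈ Ioo (-1 : ℝ) 1) : HasDerivAt (fun y => Real.arccos y ^ 2)
      (-2 * Real.arccos x / √(1 - x ^ 2)) x := by
    refine ((Real.hasDerivAt_arccos hx.1.ne' hx.2.ne).pow 2).congr_deriv ?_
    simp
    ring
  have hpos (x : ℝ) (hx : x ∈ Ioo (-1 : ℝ) 1) : 0 < 1 - x ^ 2 := by nlinarith [hx.1, hx.2]
  have hx1 : AnalyticAt ℝ (fun x : ℝ => 1 - x ^ 2) 1 := by fun_prop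
  constructor
  -- Identity theorem: a relation checked only to the left of 1 holds on a full neighbourhood.
  · refine (AnalyticAt.frequently_eq_iff_eventually_eq (hx1.mul (hg.deriv.pow 2))
      (analyticAt_const.mul hg)).1 (Eventually.frequently ?_ |>.filter_mono hsub)
    filter_upwards [h1, hmem] with x hx hxm
    have hs := Real.sq_sqrt (hpos x hxm).le
    have hs0 := (Real.sqrt_pos.2 (hpos x hxm)).ne'
    simp only [Pi.mul_apply, Pi.pow_apply]
    rw [hx.deriv_eq, (hder x hxm).deriv, hx.eq_of_nhds, div_pow, hs]
    field_simp [(hpos x hxm).ne']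
    ring
  · refine (AnalyticAt.frequently_eq_iff_eventually_eq ((hx1.mul hg.deriv.deriv).sub
      (analyticAt_id.mul hg.deriv)) analyticAt_const).1 (Eventually.frequently ?_ |>.filter_mono hsub)
    filter_upwards [h1, hmem] with x hx hxm
    have hs := Real.sq_sqrt (hpos x hxm).le
    have hs0 := (Real.sqrt_pos.2 (hpos x hxm)).ne'
    have hd1 : deriv g =ᶠ[𝓝 x] fun y => -2 * Real.arccos y / √(1 - y ^ 2) := by
      refine hx.deriv.trans ?_
      filter_upwards [Ioo_mem_nhds hxm.1 hxm.2] with y hy using (hder y hy).deriv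
    have hsq : HasDerivAt (fun y : ℝ => √(1 - y ^ 2)) (-(2 * x) / (2 * √(1 - x ^ 2))) x := by
      refine HasDerivAt.sqrt ?_ (hpos x hxm).ne'
      simpa using ((hasDerivAt_id x).pow 2).const_sub 1
    have hd2 := (((Real.hasDerivAt_arccos hxm.1.ne' hxm.2.ne).const_mul (-2)).div hsq hs0).deriv
    have hd2' : deriv (deriv g) x = _ := hd1.deriv_eq.trans hd2
    simp only [Pi.mul_apply, Pi.sub_apply, id]
    rw [hd2', hd1.eq_of_nhds]
    generalize √(1 - x ^ 2) = s at *
    rw [← hs]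
    field_simp
    ring

theorem pow_ode {g : ℝ → ℝ} (hg : AnalyticAt ℝ g 1)
    (h1 : ∀ᶠ x in 𝓝 1, (1 - x ^ 2) * deriv g x ^ 2 = 4 * g x)
    (h2 : ∀ᶠ x in 𝓝 1, (1 - x ^ 2) * deriv (deriv g) x - x * deriv g x = 2) (k : ℕ) :
    ∀ᶠ x in 𝓝 1, (1 - x ^ 2) * deriv (deriv fun y => g y ^ (k + 1)) x -
      x * deriv (fun y => g y ^ (k + 1)) x = (2 * k + 2) * (2 * k + 1) * g x ^ k := by
  have hd : ∀ᶠ x in 𝓝 (1 : ℝ), deriv (fun y => g y ^ (k + 1)) x =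
      (k + 1) * g x ^ k * deriv g x := by
    filter_upwards [hg.eventually_analyticAt] with x hx
    rw [(hx.differentiableAt.hasDerivAt.fun_pow (k + 1)).deriv]
    simp
  filter_upwards [h1, h2, hd.eventually_nhds, hg.eventually_analyticAt] with x h1 h2 hd hx
  have hdd : deriv (deriv fun y => g y ^ (k + 1)) x =
      (k + 1) * (k * g x ^ (k - 1) * deriv g x) * deriv g x
        + (k + 1) * g x ^ k * deriv (deriv g) x := by
    rw [EventuallyEq.deriv_eq hd]
    exact (((hx.differentiableAt.hasDerivAt.fun_pow k).const_mul ((k : ℝ) + 1)).mul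
      hx.deriv.differentiableAt.hasDerivAt).deriv
  rw [hdd, Eventually.self_of_nhds hd]
  have h3 : (k : ℝ) * g x ^ (k - 1) * g x = k * g x ^ k := by
    cases k with
    | zero => simp
    | succ k => simp [pow_succ, mul_assoc]
  linear_combination ((k : ℝ) + 1) * k * g x ^ (k - 1) * h1 + (k + 1) * g x ^ k * h2
    + 4 * (k + 1) * h3

theorem iteratedDeriv_ode {y z : ℝ → ℝ} {c : ℝ} (hy : AnalyticAt ℝ y 1) (hz : AnalyticAt ℝ z 1)
    (h : ∀ᶠ x in 𝓝 1, (1 - x ^ 2) * deriv (deriv y) x - x * deriv y x = c * z x) (n : ℕ) :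
    ∀ᶠ x in 𝓝 1, (1 - x ^ 2) * iteratedDeriv (n + 2) y x
      - (2 * n + 1) * x * iteratedDeriv (n + 1) y x - n ^ 2 * iteratedDeriv n y x =
        c * iteratedDeriv n z x := by
  have hA {f : ℝ → ℝ} {x : ℝ} (hf : AnalyticAt ℝ f x) (m : ℕ) :
      HasDerivAt (iteratedDeriv m f) (iteratedDeriv (m + 1) f x) x := by
    rw [iteratedDeriv_succ, iteratedDeriv_eq_iterate]
    exact (hf.iterated_deriv m).differentiableAt.hasDerivAt
  induction n with
  | zero => simpa [iteratedDeriv_succ, iteratedDeriv_zero] using h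
  | succ n ih =>
    filter_upwards [ih.eventually_nhds, hy.eventually_analyticAt, hz.eventually_analyticAt]
      with x hx hyx hzx
    have h1 : HasDerivAt (fun t : ℝ => 1 - t ^ 2) (-(2 * x)) x := by
      simpa using ((hasDerivAt_id x).pow 2).const_sub 1
    have h2 : HasDerivAt (fun t : ℝ => (2 * (n : ℝ) + 1) * t) (2 * n + 1) x := by
      simpa using (hasDerivAt_id x).const_mul (2 * (n : ℝ) + 1)
    have hL := ((h1.mul (hA hyx (n + 2))).sub (h2.mul (hA hyx (n + 1)))).sub
      ((hA hyx n).const_mul ((n : ℝ) ^ 2))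
    have hR := (hA hzx n).const_mul c
    have he := (hL.congr_of_eventuallyEq (EventuallyEq.symm hx)).unique hR
    push_cast
    linear_combination he

theorem iteratedDeriv_pow_one {g : ℝ → ℝ} (hg : AnalyticAt ℝ g 1) (hg1 : g 1 = 0)
    (h1 : ∀ᶠ x in 𝓝 1, (1 - x ^ 2) * deriv g x ^ 2 = 4 * g x)
    (h2 : ∀ᶠ x in 𝓝 1, (1 - x ^ 2) * deriv (deriv g) x - x * deriv g x = 2) (k n : ℕ) :
    iteratedDeriv n (fun x => g x ^ k) 1 =
      (-1) ^ k * ((2 * k)! / (2 * n - 1)‼) * (centralFactorialPoly n).coeff k := by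
  induction n generalizing k with
  | zero => cases k <;> simp [centralFactorialPoly, hg1, Polynomial.coeff_one]
  | succ n ih =>
    cases k with
    | zero => simp [coeff_centralFactorialPoly_succ_zero, iteratedDeriv_const]
    | succ k =>
      have h := (iteratedDeriv_ode (hg.fun_pow (k + 1)) (hg.fun_pow k)
        (pow_ode hg h1 h2 k) n).self_of_nhds
      rw [ih, ih] at h
      have hf : ((2 * (k + 1))! : ℝ) = (2 * k + 2) * (2 * k + 1) * (2 * k)! := by
        rw [show 2 * (k + 1) = 2 * k + 1 + 1 by ring, Nat.factorial_succ, Nat.factorial_succ]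
        push_cast
        ring
      -- At `n = 0` the truncated subtraction gives `0‼ = 1`, the conventional value of `(-1)‼`.
      have hdf : ((2 * (n + 1) - 1)‼ : ℝ) = (2 * n + 1) * (2 * n - 1)‼ := by
        cases n with
        | zero => simp
        | succ n =>
          rw [show 2 * (n + 1 + 1) - 1 = (2 * n + 1) + 2 by omega, Nat.doubleFactorial_add_two,
            show 2 * (n + 1) - 1 = 2 * n + 1 by omega]
          push_cast
          ring
      have hpos : ((2 * n - 1)‼ : ℝ) ≠ 0 := mod_cast (Nat.doubleFactorial_pos _).ne'
      have hn : (2 * (n : ℝ) + 1) ≠ 0 := by positivity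
      rw [centralFactorialPoly_succ, mul_sub, Polynomial.coeff_sub, Polynomial.coeff_mul_X,
        Polynomial.coeff_mul_C, hdf, hf]
      rw [hf] at h
      field_simp at h ⊢
      rw [pow_succ] at h ⊢
      linear_combination -h

/-! ### One-sided derivatives and the passage to `arccosh` -/

theorem hasLeftIteratedDeriv_of_analyticAt {F : Type*} [NormedAddCommGroup F] [NormedSpace ℝ F]
    [CompleteSpace F] {f h : ℝ → F} {a : ℝ} (n : ℕ) (hh : AnalyticAt ℝ h a)
    (hf : f =ᶠ[𝓝[≤] a] h) : HasLeftIteratedDeriv n f (iteratedDeriv n h a) a where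
  contDiffWithinAt := hh.contDiffAt.contDiffWithinAt.congr_of_eventuallyEq hf
    (hf.self_of_nhdsWithin self_mem_Iic)
  iteratedDerivWithin_eq := by
    rw [hf.iteratedDerivWithin_eq (hf.self_of_nhdsWithin self_mem_Iic),
      iteratedDerivWithin_eq_iteratedDeriv (uniqueDiffOn_Iic a) hh.contDiffAt self_mem_Iic]
  tendsto_iteratedDeriv := by
    have hc : Tendsto (iteratedDeriv n h) (𝓝[<] a) (𝓝 (iteratedDeriv n h a)) := by
      rw [iteratedDeriv_eq_iterate]
      exact (hh.iterated_deriv n).continuousAt.tendsto.mono_left nhdsWithin_le_nhds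
    refine hc.congr' ?_
    have := eventually_eventually_nhdsWithin.2
      (hf.filter_mono (nhdsWithin_mono _ Iio_subset_Iic_self))
    filter_upwards [this, self_mem_nhdsWithin] with x hx hx1
    rw [isOpen_Iio.nhdsWithin_eq hx1] at hx
    exact (EventuallyEq.iteratedDeriv_eq n hx).symm

theorem iteratedDeriv_ofReal_comp {f : ℝ → ℝ} {a : ℝ} (hf : AnalyticAt ℝ f a) (n : ℕ) :
    iteratedDeriv n (fun x => (f x : ℂ)) a = ((iteratedDeriv n f a : ℝ) : ℂ) := by
  suffices ∀ᶠ x in 𝓝 a, iteratedDeriv n (fun x => (f x : ℂ)) x = ((iteratedDeriv n f x : ℝ) : ℂ) from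
    this.self_of_nhds
  induction n with
  | zero => simp [iteratedDeriv_zero]
  | succ n ih =>
    filter_upwards [ih.eventually_nhds, hf.eventually_analyticAt] with x hx hfx
    rw [iteratedDeriv_succ, iteratedDeriv_succ, EventuallyEq.deriv_eq hx]
    refine HasDerivAt.deriv (HasDerivAt.ofReal_comp ?_)
    rw [iteratedDeriv_eq_iterate]
    exact (hfx.iterated_deriv n).differentiableAt.hasDerivAt

theorem complexArccosh_ofReal {x : ℝ} (h1 : -1 ≤ x) (h2 : x ≤ 1) :
    complexArccosh x = Complex.I * Real.arccos x := by
  have hs : ((x : ℂ) + 1) ^ (1 / 2 : ℂ) * ((x : ℂ) - 1) ^ (1 / 2 : ℂ) =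
      Complex.I * √(1 - x ^ 2) := by
    have e1 : ((x : ℂ) + 1) ^ (1 / 2 : ℂ) = (√(1 + x) : ℝ) := by
      rw [Real.sqrt_eq_rpow, Complex.ofReal_cpow (by linarith)]
      push_cast
      rw [add_comm]
    have e2 : ((x : ℂ) - 1) ^ (1 / 2 : ℂ) = Complex.I * (√(1 - x) : ℝ) := by
      have := Complex.ofReal_cpow_of_nonpos (x := x - 1) (by linarith) (1 / 2)
      push_cast at this
      rw [this, Real.sqrt_eq_rpow, Complex.ofReal_cpow (by linarith)]
      rw [show (Real.pi : ℂ) * Complex.I * (1 / 2) = Real.pi / 2 * Complex.I by ring,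
        Complex.exp_pi_div_two_mul_I]
      push_cast
      rw [neg_sub, mul_comm]
    rw [e1, e2, show (1 - x ^ 2) = (1 + x) * (1 - x) by ring, Real.sqrt_mul (by linarith)]
    push_cast
    ring
  rw [complexArccosh, hs]
  have he : (x : ℂ) + Complex.I * √(1 - x ^ 2) = Complex.exp (Real.arccos x * Complex.I) := by
    rw [Complex.exp_mul_I, ← Complex.ofReal_cos, ← Complex.ofReal_sin, Real.cos_arccos h1 h2,
      Real.sin_arccos]
    ring
  -- No branch correction arises, as `arccos x` lies in `(-π, π]`.
  rw [he, Complex.log_exp, mul_comm]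
  · simpa using lt_of_lt_of_le (neg_neg_of_pos Real.pi_pos) (Real.arccos_nonneg x)
  · simpa using Real.arccos_le_pi x

theorem corollary4p4 (k n : ℕ) (hk : 1 ≤ k) (hn : 1 ≤ n) :
    HasLeftIteratedDeriv n (fun x : ℝ => Real.arccos x ^ (2 * k))
      (if n < k then (0 : ℝ)
        else if n = k then (-1 : ℝ) ^ k * ((2 * k)‼ : ℝ)
        else (-1 : ℝ) ^ k * (((2 * k)! : ℝ) / ((2 * n - 1)‼ : ℝ))
          * stirlingQ (2 * k) (2 * n - 2 * k)) 1
    ∧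
    HasLeftIteratedDeriv n (fun x : ℝ => complexArccosh (x : ℂ) ^ (2 * k))
      (((if n < k then (0 : ℝ)
        else if n = k then ((2 * k)‼ : ℝ)
        else (((2 * k)! : ℝ) / ((2 * n - 1)‼ : ℝ))
          * stirlingQ (2 * k) (2 * n - 2 * k)) : ℝ) : ℂ) 1 := by
  obtain ⟨g, hg, hgeq⟩ := exists_analyticAt_eq_arccos_sq
  obtain ⟨h1, h2⟩ := arccos_sq_ode hg hgeq
  have hg1 : g 1 = 0 := by simpa using hgeq.self_of_nhdsWithin self_mem_Iic
  have hval := iteratedDeriv_pow_one hg hg1 h1 h2 k n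
  set v : ℝ := if n < k then (0 : ℝ)
        else if n = k then ((2 * k)‼ : ℝ)
        else (((2 * k)! : ℝ) / ((2 * n - 1)‼ : ℝ))
          * stirlingQ (2 * k) (2 * n - 2 * k) with hv
  have hcoeff : ((2 * k)! / (2 * n - 1)‼ : ℝ) * (centralFactorialPoly n).coeff k = v := by
    rw [hv]
    split_ifs with hlt heq
    · rw [Polynomial.coeff_eq_zero_of_natDegree_lt (by rwa [natDegree_centralFactorialPoly]),
        mul_zero]
    · subst heq
      have hm := (monic_centralFactorialPoly n).coeff_natDegree
      rw [natDegree_centralFactorialPoly] at hm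
      obtain ⟨m, rfl⟩ := Nat.exists_eq_add_of_le' hk
      rw [hm, mul_one, show 2 * (m + 1) - 1 = 2 * m + 1 by omega,
        show 2 * (m + 1) = 2 * m + 1 + 1 by ring, Nat.factorial_eq_mul_doubleFactorial]
      push_cast
      exact mul_div_cancel_right₀ _ (mod_cast (Nat.doubleFactorial_pos _).ne')
    · rw [stirlingQ_eq_coeff hk (by omega)]
  rw [mul_assoc, hcoeff] at hval
  constructor
  · have hL := hasLeftIteratedDeriv_of_analyticAt n (hg.fun_pow k)
      (f := fun x : ℝ => Real.arccos x ^ (2 * k))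
      (hgeq.mono fun x hx => by simp only [hx, pow_mul])
    rw [hval] at hL
    convert hL using 1
    rw [hv]
    split_ifs <;> ring
  · have han : AnalyticAt ℝ (fun x => (-1 : ℝ) ^ k * g x ^ k) 1 :=
      analyticAt_const.mul (hg.fun_pow k)
    have hanC : AnalyticAt ℝ (fun x => (((-1 : ℝ) ^ k * g x ^ k : ℝ) : ℂ)) 1 :=
      (Complex.ofRealCLM.analyticAt _).comp han
    have hL := hasLeftIteratedDeriv_of_analyticAt n hanC
      (f := fun x : ℝ => complexArccosh (x : ℂ) ^ (2 * k)) (by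
        have hm : ∀ᶠ x in 𝓝[≤] (1 : ℝ), -1 ≤ x :=
          nhdsWithin_le_nhds (Ici_mem_nhds (by norm_num))
        filter_upwards [hgeq, hm, self_mem_nhdsWithin] with x hx hx1 hx2
        rw [complexArccosh_ofReal hx1 hx2, hx, mul_pow, pow_mul, pow_mul, Complex.I_sq]
        push_cast
        rfl)
    rw [iteratedDeriv_ofReal_comp han, iteratedDeriv_const_mul_field, hval, ← mul_assoc,
      ← mul_pow] at hL
    simpa using hL
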